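/- Let $G$ be a group. For $x,g\in G$ write $[x,g]=x^{-1}g^{-1}xg$, and define $[x,{}_0\,g]=x$ and $[x,{}_{n+1}\,g]=[[x,{}_n\,g],g]$ for $n\ge 0$. An element $g\in G$ is called almost Engel (in $G$) if there is a finite set $\mathcal E\subseteq G$ such that for every $x\in G$ there is a positive integer $n(x,g)$ with $[x,{}_n\,g]\in\mathcal E$ for all $n\ge n(x,g)$. **Theorem.** Let $G$ be a group that has a soluble subgroup of finite index and is generated by finitely many almost Engel elements. Then $G$ is finite-by-nilpotent, that is, $G$ has a finite normal subgroup $N$ such that $G/N$ is nilpotent. -/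

import Mathlib

namespace AlmostEngel

variable {G : Type*} [Group G]

/-- The iterated commutator `[x, ₙ g]`: `[x, ₀ g] = x` and `[x, ₙ₊₁ g] = [[x, ₙ g], g]`,
where `[y, g] = y⁻¹ g⁻¹ y g`. -/
def iterComm (x g : G) : ℕ → G
  | 0 => x
  | n + 1 => (iterComm x g n)⁻¹ * g⁻¹ * iterComm x g n * g

/-- An element `g` of `G` is almost Engel if there is a finite subset `E` of `G` such that for
every `x` in `G` all sufficiently long commutators `[x, ₙ g]` belong to `E`. -/
def IsAlmostEngel (g : G) : Prop :=
  ∃ E : Set G, E.Finite ∧ ∀ x : G, ∃ n₀ : ℕ, 0 < n₀ ∧ ∀ n : ℕ, n₀ ≤ n → iterComm x g n ∈ E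

variable (G)

/-- `G` has a soluble subgroup of finite index. -/
def IsVirtuallySoluble : Prop :=
  ∃ H : Subgroup G, H.FiniteIndex ∧ Group.IsSolvable H

/-- `G` has a finite normal subgroup with nilpotent quotient. -/
def IsFiniteByNilpotent : Prop :=
  ∃ (N : Subgroup G) (_ : N.Normal), Finite N ∧ Group.IsNilpotent (G ⧸ N)

end AlmostEngel

/-!
A subgroup is called finite-by-nilpotent here if some term of its lower central series is finite.
The proof is by induction on the derived length of a soluble normal subgroup `H` of finite index:
`A` is the last nontrivial term of the derived series of `H`, an abelian normal subgroup of `G`, and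
`G / A` is finite-by-nilpotent.

Let `a` be almost Engel. Iterating the endomorphism `φ : x ↦ [x, a]` of `A` takes every element into
the subgroup of `φ`-periodic points, which is finite. Therefore every finitely generated subgroup of
`A⟨a⟩` is finite-by-nilpotent (`locFinByNil_sup_zpowers`). The theorems of Fitting and of Hirsch and
Plotkin hold with "finite-by-nilpotent" for "nilpotent" (`FinByNil.sup`, `LocFinByNil.sup`), the
latter because finitely generated finite-by-nilpotent groups satisfy the maximal condition
(`FinByNil.fg_of_le`). Hence every group has a largest normal locally finite-by-nilpotent subgroup,
and this radical contains all subnormal locally finite-by-nilpotent subgroups.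

A suitable subgroup `C` of finite index in `G` contains `A` and is nilpotent modulo `A`. With `k` the
index of `C`, the subgroups `A⟨aᵏ⟩`, for `a` a generator, are subnormal in `C`, so they lie in the
radical `R` of `C`. Now `G / R` is finite-by-nilpotent and generated by finitely many torsion
elements, hence finite. So `R` is finitely generated, hence finite-by-nilpotent, and modulo a finite
normal subgroup `G` is virtually nilpotent
(`finByNil_top_of_quotient_isMulCommutative`).

In the virtually nilpotent case (`finByNil_top_of_nilpotent_finiteIndex`) let `A` be the last
nontrivial term of the lower central series of the nilpotent subgroup of finite index. A generator
acts on `A` by an automorphism of finite order that is unipotent modulo torsion, so it acts trivially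
modulo torsion. Thus, modulo a finite normal subgroup, `A` is central, and Schur's theorem carries
the finite-by-nilpotent property from `G / A` to `G` (`finByNil_top_of_le_center`).
-/

namespace AlmostEngel

open Subgroup
open scoped commutatorElement

section

variable {G : Type*} [Group G]

/-! ### Commutators of subgroups given by generators -/

theorem le_normalizer_of_conj_mem {X : Set G} {Q : Subgroup G} (hX : ∀ x ∈ X, x⁻¹ ∈ X)
    (h : ∀ x ∈ X, ∀ q ∈ Q, x * q * x⁻¹ ∈ Q) : closure X ≤ normalizer (Q : Set G) := by
  rw [closure_le]
  intro x hx
  rw [SetLike.mem_coe, mem_normalizer_iff]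
  refine fun q => ⟨h x hx q, fun hq => ?_⟩
  have := h _ (hX x hx) _ hq
  simpa [mul_assoc] using this

/-- To bound `⁅closure X, closure Y⁆` by a subgroup `P` normalised by both sides, it suffices to
look at the commutators of generators: both conditions cut out subgroups of the normaliser
of `P`. -/
theorem commutator_closure_le {X Y : Set G} {P : Subgroup G}
    (hX : X ⊆ normalizer (P : Set G)) (hY : Y ⊆ normalizer (P : Set G))
    (h : ∀ x ∈ X, ∀ y ∈ Y, ⁅x, y⁆ ∈ P) : ⁅closure X, closure Y⁆ ≤ P := by
  have key : ∀ g : G, ∀ Z : Set G, Z ⊆ normalizer (P : Set G) → (∀ z ∈ Z, ⁅g, z⁆ ∈ P) →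
      ∀ z ∈ closure Z, ⁅g, z⁆ ∈ P := by
    intro g Z hZ hg z hz
    have hN : ∀ w ∈ closure Z, w ∈ normalizer (P : Set G) := fun w hw => (closure_le _).2 hZ hw
    induction hz using closure_induction with
    | mem z hz => exact hg z hz
    | one => simp
    | mul a b ha hb iha ihb =>
      have : ⁅g, a * b⁆ = ⁅g, a⁆ * (a * ⁅g, b⁆ * a⁻¹) := by
        simp only [commutatorElement_def]; group
      rw [this]
      exact mul_mem iha ((mem_normalizer_iff.1 (hN a ha) _).1 ihb)
    | inv a ha iha =>
      have : ⁅g, a⁻¹⁆ = a⁻¹ * ⁅g, a⁆⁻¹ * a⁻¹⁻¹ := by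
        simp only [commutatorElement_def]; group
      rw [this]
      exact (mem_normalizer_iff.1 (inv_mem (hN a ha)) _).1 (inv_mem iha)
  rw [commutator_le]
  intro g hg y hy
  refine key g Y hY (fun y hy => ?_) y hy
  rw [← inv_mem_iff, commutatorElement_inv]
  refine key y X hX (fun x hx => ?_) g hg
  rw [← inv_mem_iff, commutatorElement_inv]
  exact h x hx y hy

theorem commutator_sup_left_le {A B C P : Subgroup G} (hA : A ≤ normalizer (P : Set G))
    (hB : B ≤ normalizer (P : Set G)) (hC : C ≤ normalizer (P : Set G))
    (h₁ : ⁅A, C⁆ ≤ P) (h₂ : ⁅B, C⁆ ≤ P) : ⁅A ⊔ B, C⁆ ≤ P := by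
  rw [← closure_eq C, sup_eq_closure]
  refine commutator_closure_le (Set.union_subset hA hB) hC ?_
  rintro x (hx | hx) y hy
  · exact commutator_le.1 h₁ x hx y hy
  · exact commutator_le.1 h₂ x hx y hy

theorem commutator_sup_right_le {A B C P : Subgroup G} (hA : A ≤ normalizer (P : Set G))
    (hB : B ≤ normalizer (P : Set G)) (hC : C ≤ normalizer (P : Set G))
    (h₁ : ⁅C, A⁆ ≤ P) (h₂ : ⁅C, B⁆ ≤ P) : ⁅C, A ⊔ B⁆ ≤ P := by
  rw [commutator_comm] at *
  exact commutator_sup_left_le hA hB hC h₁ h₂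

theorem normalizer_le_normalizer_lowerCentralSeries (H : Subgroup G) (n : ℕ) :
    normalizer (H : Set G) ≤ normalizer (H.lowerCentralSeries n : Set G) := by
  intro g hg
  rw [mem_normalizer_iff_map_conj_eq] at hg ⊢
  rw [map_lowerCentralSeries, hg]

theorem lowerCentralSeries_le_of_commutator_le {K : Subgroup G} {D : ℕ → Subgroup G}
    (h0 : K ≤ D 0) (h : ∀ i, ⁅D i, K⁆ ≤ D (i + 1)) (n : ℕ) : K.lowerCentralSeries n ≤ D n := by
  induction n with
  | zero => exact h0
  | succ n ih => exact (commutator_mono ih le_rfl).trans (h n)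

/-! ### Finite-by-nilpotent subgroups -/

/-- A subgroup is finite-by-nilpotent if some term of its lower central series is finite. For the
whole group this agrees with `IsFiniteByNilpotent`, and it needs no quotients. -/
def FinByNil (K : Subgroup G) : Prop :=
  ∃ n, (K.lowerCentralSeries n : Set G).Finite

theorem FinByNil.mono {K M : Subgroup G} (hK : FinByNil K) (h : M ≤ K) : FinByNil M := by
  obtain ⟨n, hn⟩ := hK
  exact ⟨n, hn.subset (lowerCentralSeries_mono n h)⟩

theorem FinByNil.map {G' : Type*} [Group G'] {K : Subgroup G} (hK : FinByNil K) (f : G →* G') :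
    FinByNil (K.map f) := by
  obtain ⟨n, hn⟩ := hK
  refine ⟨n, ?_⟩
  rw [← map_lowerCentralSeries, coe_map]
  exact hn.image f

theorem FinByNil.of_map {G' : Type*} [Group G'] {K : Subgroup G} {f : G →* G'}
    (hf : (f.ker : Set G).Finite) (hK : FinByNil (K.map f)) : FinByNil K := by
  obtain ⟨n, hn⟩ := hK
  refine ⟨n, ?_⟩
  rw [← map_lowerCentralSeries, coe_map] at hn
  refine Set.Finite.of_finite_fibers f hn ?_
  rintro _ ⟨x, hx, rfl⟩
  refine (hf.image (fun k => x * k)).subset ?_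
  rintro y ⟨-, hy⟩
  refine ⟨x⁻¹ * y, ?_, by simp⟩
  simp only [Set.mem_preimage, Set.mem_singleton_iff] at hy
  simp [MonoidHom.mem_ker, hy]

theorem FinByNil.of_quotient {T : Subgroup G} [T.Normal] (hT : (T : Set G).Finite)
    (h : FinByNil (⊤ : Subgroup (G ⧸ T))) : FinByNil (⊤ : Subgroup G) := by
  refine FinByNil.of_map (f := QuotientGroup.mk' T) (by simpa using hT) (h.mono le_top)

theorem FinByNil.isFiniteByNilpotent (h : FinByNil (⊤ : Subgroup G)) : IsFiniteByNilpotent G := by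
  obtain ⟨n, hn⟩ := h
  refine ⟨(⊤ : Subgroup G).lowerCentralSeries n, inferInstance, hn.to_subtype, ?_⟩
  rw [Subgroup.nilpotent_iff_lowerCentralSeries]
  refine ⟨n, ?_⟩
  rw [← map_top_of_surjective _ (QuotientGroup.mk'_surjective _), ← map_lowerCentralSeries,
    Subgroup.map_eq_bot_iff, QuotientGroup.ker_mk']

/-- `H`, `γ₁(H) = H`, `γ₂(H)`, … preceded by the ambient subgroup `W`: the `h`-th term contains all
commutators of elements of `W` with at least `h` entries in `H`. -/
def weightSeries (W H : Subgroup G) : ℕ → Subgroup G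
  | 0 => W
  | h + 1 => H.lowerCentralSeries h

theorem le_normalizer_weightSeries {W H : Subgroup G} (hW : W ≤ normalizer (H : Set G)) (h : ℕ) :
    W ≤ normalizer (weightSeries W H h : Set G) := by
  cases h with
  | zero => exact le_normalizer
  | succ h => exact hW.trans (normalizer_le_normalizer_lowerCentralSeries H h)

theorem commutator_weightSeries_le {W H : Subgroup G} (hW : W ≤ normalizer (H : Set G)) (h : ℕ) :
    ⁅weightSeries W H h, H⁆ ≤ weightSeries W H (h + 1) := by
  cases h with
  | zero => exact le_normalizer_iff_commutator_le_right.1 hW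
  | succ h => exact le_rfl

theorem weightSeries_inf_le (H K : Subgroup G) (a b : ℕ) :
    weightSeries (H ⊔ K) H a ⊓ weightSeries (H ⊔ K) K b ≤ H ⊔ K := by
  cases a with
  | zero => exact inf_le_left
  | succ a => exact inf_le_left.trans ((lowerCentralSeries_le_self H a).trans le_sup_left)

/-- The subgroup generated by the commutators of weight `N` in `H ⊔ K`, sorted by the number of
entries taken from `H` and from `K`. -/
def mixedSeries (H K : Subgroup G) (N : ℕ) : Subgroup G :=
  ⨆ p : {p : ℕ × ℕ // p.1 + p.2 = N},
    weightSeries (H ⊔ K) H p.1.1 ⊓ weightSeries (H ⊔ K) K p.1.2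

theorem le_mixedSeries (H K : Subgroup G) {a b N : ℕ} (h : a + b = N) :
    weightSeries (H ⊔ K) H a ⊓ weightSeries (H ⊔ K) K b ≤ mixedSeries H K N :=
  le_iSup (fun p : {p : ℕ × ℕ // p.1 + p.2 = N} =>
    weightSeries (H ⊔ K) H p.1.1 ⊓ weightSeries (H ⊔ K) K p.1.2) ⟨(a, b), h⟩

theorem commutator_mixedSeries_le {H K : Subgroup G} (hHK : H ≤ normalizer (K : Set G))
    (hKH : K ≤ normalizer (H : Set G)) (N : ℕ) :
    ⁅mixedSeries H K N, H ⊔ K⁆ ≤ mixedSeries H K (N + 1) := by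
  have hWH : H ⊔ K ≤ normalizer (H : Set G) := sup_le le_normalizer hKH
  have hWK : H ⊔ K ≤ normalizer (K : Set G) := sup_le hHK le_normalizer
  have hP : H ⊔ K ≤ normalizer (mixedSeries H K (N + 1) : Set G) :=
    (le_iInf fun p => (le_inf (le_normalizer_weightSeries hWH _)
      (le_normalizer_weightSeries hWK _)).trans inf_normalizer_le_normalizer_inf).trans
      (iInf_normalizer_le_normalizer_iSup _)
  have h1 : mixedSeries H K N = closure (⋃ p : {p : ℕ × ℕ // p.1 + p.2 = N},
      ((weightSeries (H ⊔ K) H p.1.1 ⊓ weightSeries (H ⊔ K) K p.1.2 : Subgroup G) : Set G)) := by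
    simp only [Subgroup.closure_iUnion, closure_eq, mixedSeries]
  have h2 : ⁅mixedSeries H K N, closure ((H : Set G) ∪ K)⁆ ≤ mixedSeries H K (N + 1) := by
    rw [h1]
    refine commutator_closure_le ?_ ?_ ?_
    · exact Set.iUnion_subset fun p => (weightSeries_inf_le H K _ _).trans hP
    · exact Set.union_subset (le_trans le_sup_left hP : H ≤ _) (le_trans le_sup_right hP : K ≤ _)
    · intro x hx y hy
      obtain ⟨⟨⟨a, b⟩, hp⟩, hx⟩ := Set.mem_iUnion.1 hx
      obtain ⟨hxa, hxb⟩ := mem_inf.1 hx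
      rcases hy with hy | hy
      · refine le_mixedSeries H K (a := a + 1) (b := b) (by simp only at hp; omega)
          (mem_inf.2 ⟨commutator_weightSeries_le hWH a (commutator_mem_commutator hxa hy), ?_⟩)
        exact le_normalizer_iff_commutator_le_left.1 (le_normalizer_weightSeries hWK b)
          (commutator_mem_commutator hxb (mem_sup_left hy))
      · refine le_mixedSeries H K (a := a) (b := b + 1) (by simp only at hp; omega)
          (mem_inf.2 ⟨?_, commutator_weightSeries_le hWK b (commutator_mem_commutator hxb hy)⟩)
        exact le_normalizer_iff_commutator_le_left.1 (le_normalizer_weightSeries hWH a)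
          (commutator_mem_commutator hxa (mem_sup_right hy))
  rwa [← sup_eq_closure] at h2

/-- **Fitting's theorem** for finite-by-nilpotent subgroups. A commutator of weight `m + n + 1` in
`H ⊔ K` has at least `m + 1` entries in `H` or at least `n + 1` entries in `K`, hence lies in the
`m`-th term of the series of `H` or in the `n`-th term of that of `K`, counted from zero. -/
theorem FinByNil.sup {H K : Subgroup G} (hHK : H ≤ normalizer (K : Set G))
    (hKH : K ≤ normalizer (H : Set G)) (hH : FinByNil H) (hK : FinByNil K) :
    FinByNil (H ⊔ K) := by
  obtain ⟨m, hm⟩ := hH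
  obtain ⟨n, hn⟩ := hK
  have hfin : ((H.lowerCentralSeries m ⊔ K.lowerCentralSeries n : Subgroup G) : Set G).Finite := by
    have hnorm : H.lowerCentralSeries m ≤ normalizer (K.lowerCentralSeries n : Set G) :=
      (lowerCentralSeries_le_self H m).trans
        (hHK.trans (normalizer_le_normalizer_lowerCentralSeries K n))
    rw [coe_mul_of_left_le_normalizer_right _ _ hnorm]
    exact hm.mul hn
  have h0 : H ⊔ K ≤ mixedSeries H K 0 :=
    (le_inf le_rfl le_rfl).trans (le_mixedSeries H K (a := 0) (b := 0) rfl)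
  have hle : (H ⊔ K).lowerCentralSeries (m + n + 1) ≤ mixedSeries H K (m + n + 1) :=
    lowerCentralSeries_le_of_commutator_le h0 (commutator_mixedSeries_le hHK hKH) _
  refine ⟨m + n + 1, hfin.subset (hle.trans (iSup_le ?_))⟩
  rintro ⟨⟨a, b⟩, hp⟩
  simp only at hp
  by_cases ha : m + 1 ≤ a
  · obtain ⟨a, rfl⟩ : ∃ c, a = c + 1 := ⟨a - 1, by omega⟩
    exact inf_le_left.trans ((Subgroup.lowerCentralSeries_antitone H (by omega)).trans le_sup_left)
  · obtain ⟨b, rfl⟩ : ∃ c, b = c + 1 := ⟨b - 1, by omega⟩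
    exact inf_le_right.trans ((Subgroup.lowerCentralSeries_antitone K (by omega)).trans le_sup_right)

/-! ### Finitely generated finite-by-nilpotent groups satisfy the maximal condition -/

theorem fg_of_fg_map_of_fg_inf_ker {G' : Type*} [Group G'] (f : G →* G') {M : Subgroup G}
    (h₁ : (M.map f).FG) (h₂ : (M ⊓ f.ker).FG) : M.FG := by
  classical
  obtain ⟨T, hT⟩ := h₁
  have hTM : (T : Set G') ⊆ f '' M := by
    rw [← coe_map, ← hT]; exact subset_closure
  obtain ⟨X, hXM, hX⟩ := Finset.subset_set_image_iff.1 hTM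
  have hM : M = closure (X : Set G) ⊔ M ⊓ f.ker := by
    apply le_antisymm
    · intro m hm
      have hfm : f m ∈ (closure (X : Set G)).map f := by
        rw [MonoidHom.map_closure, ← Finset.coe_image, hX, hT]
        exact mem_map_of_mem f hm
      obtain ⟨c, hc, hcm⟩ := hfm
      have hcM : c ∈ M := (closure_le M).2 hXM hc
      rw [← mul_inv_cancel_left c m]
      refine mul_mem_sup hc (mem_inf.2 ⟨mul_mem (inv_mem hcM) hm, ?_⟩)
      rw [MonoidHom.mem_ker, map_mul, map_inv, hcm, inv_mul_cancel]
    · exact sup_le ((closure_le M).2 hXM) inf_le_left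
  rw [hM]
  exact FG.sup ⟨X, rfl⟩ h₂

theorem fg_map {G' : Type*} [Group G'] {M : Subgroup G} (hM : M.FG) (f : G →* G') :
    (M.map f).FG := by
  obtain ⟨S, hS, hSf⟩ := (Subgroup.fg_iff M).1 hM
  exact (Subgroup.fg_iff _).2 ⟨f '' S, by rw [← hS, MonoidHom.map_closure], hSf.image f⟩

theorem fg_subgroup_of_isMulCommutative {A : Type*} [Group A] [IsMulCommutative A] [Group.FG A]
    (M : Subgroup A) : M.FG := by
  let _ : CommGroup A := { (inferInstance : Group A) with mul_comm := mul_comm' }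
  have h : Module.Finite ℤ (Additive A) := Module.Finite.iff_addGroup_fg.2 inferInstance
  rw [Subgroup.fg_iff_add_fg]
  have := (inferInstance : IsNoetherian ℤ (Additive A)).noetherian
    (AddSubgroup.toIntSubmodule M.toAddSubgroup)
  rw [Submodule.fg_iff_addSubgroup_fg] at this
  simpa using this

theorem fg_of_le_of_commutator_eq_bot {A M : Subgroup G} (hA : ⁅A, A⁆ = ⊥) (hfg : A.FG)
    (hM : M ≤ A) : M.FG := by
  have : IsMulCommutative A := commutator_self_eq_bot_iff.1 hA
  have : Group.FG A := (Group.fg_iff_subgroup_fg A).2 hfg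
  have := fg_map (fg_subgroup_of_isMulCommutative (M.subgroupOf A)) A.subtype
  rwa [map_subgroupOf_eq_of_le hM] at this

/-- Modulo the next term, every term of the lower central series of a finitely generated group is
finitely generated: if `X` generates `γᵢ` modulo `γᵢ₊₁` and `S` generates `G`, then the commutators
`⁅x, s⁆` generate `γᵢ₊₁` modulo `γᵢ₊₂`. -/
theorem exists_finite_lowerCentralSeries_eq (hG : (⊤ : Subgroup G).FG) (i : ℕ) :
    ∃ X : Set G, X.Finite ∧ (⊤ : Subgroup G).lowerCentralSeries i =
      closure X ⊔ (⊤ : Subgroup G).lowerCentralSeries (i + 1) := by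
  obtain ⟨S, hS⟩ := hG
  induction i with
  | zero => exact ⟨S, S.finite_toSet, by rw [hS]; simp⟩
  | succ i ih =>
    obtain ⟨X, hXfin, hX⟩ := ih
    set γ := (⊤ : Subgroup G).lowerCentralSeries with hγ
    have hXγ : X ⊆ γ i := by rw [hX]; exact subset_closure.trans (SetLike.coe_subset_coe.2 le_sup_left)
    let Y : Set G := Set.image2 (fun x s => ⁅x, s⁆) X S
    have hYγ : closure Y ≤ γ (i + 1) := by
      rw [closure_le]
      rintro _ ⟨x, hx, s, -, rfl⟩
      exact commutator_mem_commutator (hXγ hx) (mem_top s)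
    let P := closure Y ⊔ γ (i + 2)
    have hPγ : P ≤ γ (i + 1) :=
      sup_le hYγ ((⊤ : Subgroup G).lowerCentralSeries_antitone (Nat.le_succ _))
    have hPn : P.Normal := by
      rw [← commutator_top_right_le_iff]
      exact (commutator_mono hPγ le_rfl).trans le_sup_right
    refine ⟨Y, hXfin.image2 _ S.finite_toSet, le_antisymm ?_ hPγ⟩
    have hgen : γ i = closure (X ∪ γ (i + 1)) := by
      rw [Subgroup.closure_union, closure_eq, ← hX]
    change ⁅γ i, ⊤⁆ ≤ P
    rw [hgen, ← hS]
    have hnorm : ∀ Z : Set G, Z ⊆ normalizer (P : Set G) := fun Z z _ => by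
      rw [normalizer_eq_top]; trivial
    refine commutator_closure_le (hnorm _) (hnorm _) ?_
    rintro x (hx | hx) s hs
    · exact mem_sup_left (subset_closure ⟨x, hx, s, hs, rfl⟩)
    · exact mem_sup_right (commutator_mem_commutator hx (mem_top s))

theorem fg_of_finByNil_top (hG : (⊤ : Subgroup G).FG) (h : FinByNil (⊤ : Subgroup G))
    (M : Subgroup G) : M.FG := by
  obtain ⟨n, hn⟩ := h
  set γ := (⊤ : Subgroup G).lowerCentralSeries with hγ
  have key : ∀ j i, i + j = n → ∀ M ≤ γ i, M.FG := by
    intro j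
    induction j with
    | zero =>
      intro i hi M hM
      obtain rfl : i = n := hi
      have : Finite M := (hn.subset hM).to_subtype
      exact (Group.fg_iff_subgroup_fg M).1 inferInstance
    | succ j ih =>
      intro i hi M hM
      let f := QuotientGroup.mk' (γ (i + 1))
      refine fg_of_fg_map_of_fg_inf_ker f ?_ (ih (i + 1) (by omega) _ ?_)
      · refine fg_of_le_of_commutator_eq_bot (A := (γ i).map f) ?_ ?_ (map_mono hM)
        · rw [← map_commutator, Subgroup.map_eq_bot_iff, QuotientGroup.ker_mk']
          exact commutator_mono le_rfl le_top
        · obtain ⟨X, hX, hXi⟩ := exists_finite_lowerCentralSeries_eq hG i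
          have h0 : (γ (i + 1)).map f = ⊥ := by
            rw [Subgroup.map_eq_bot_iff, QuotientGroup.ker_mk']
          have h1 : (γ i).map f = (closure X).map f := by
            rw [← sup_bot_eq ((closure X).map f), ← h0, ← Subgroup.map_sup]
            exact congrArg _ hXi
          rw [h1]
          exact fg_map ((Subgroup.fg_iff _).2 ⟨X, rfl, hX⟩) f
      · rw [QuotientGroup.ker_mk']; exact inf_le_right
  exact key n 0 (by simp) M le_top

theorem FinByNil.top_of_subtype {K : Subgroup G} (hK : FinByNil K) :
    FinByNil (⊤ : Subgroup K) := by
  refine FinByNil.of_map (f := K.subtype) (by simp) ?_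
  rwa [← MonoidHom.range_eq_map, range_subtype]

theorem FinByNil.fg_of_le {K M : Subgroup G} (h : FinByNil K) (hK : K.FG) (hM : M ≤ K) :
    M.FG := by
  have h1 : (⊤ : Subgroup K).FG := ((Group.fg_iff_subgroup_fg K).2 hK).1
  have := fg_map (fg_of_finByNil_top h1 h.top_of_subtype (M.subgroupOf K)) K.subtype
  rwa [map_subgroupOf_eq_of_le hM] at this

/-! ### Locally finite-by-nilpotent subgroups -/

/-- All finitely generated subgroups of `K` are finite-by-nilpotent. -/
def LocFinByNil (K : Subgroup G) : Prop :=
  ∀ M ≤ K, M.FG → FinByNil M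

theorem LocFinByNil.mono {K M : Subgroup G} (hK : LocFinByNil K) (h : M ≤ K) : LocFinByNil M :=
  fun _ hN hfg => hK _ (hN.trans h) hfg

theorem FinByNil.locFinByNil {K : Subgroup G} (hK : FinByNil K) : LocFinByNil K :=
  fun _ hM _ => hK.mono hM

theorem LocFinByNil.map {G' : Type*} [Group G'] {K : Subgroup G} (hK : LocFinByNil K)
    {f : G →* G'} (hf : Function.Injective f) : LocFinByNil (K.map f) := by
  intro M hM hfg
  have hMf : (M.comap f).map f = M := map_comap_eq_self (hM.trans (map_le_range f K))
  rw [← hMf] at hM hfg ⊢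
  refine FinByNil.map (hK _ ((map_le_map_iff_of_injective hf).1 hM) ?_) f
  refine fg_of_fg_map_of_fg_inf_ker f hfg ?_
  rw [(MonoidHom.ker_eq_bot_iff f).2 hf, inf_bot_eq]
  exact FG.bot

theorem exists_le_of_fg_of_le_sSup {D : Set (Subgroup G)} (hne : D.Nonempty)
    (hD : DirectedOn (· ≤ ·) D) {M : Subgroup G} (hM : M.FG) (hle : M ≤ sSup D) :
    ∃ K ∈ D, M ≤ K := by
  classical
  obtain ⟨S, rfl⟩ := hM
  rw [closure_le] at hle
  have : ∀ S : Finset G, (S : Set G) ⊆ (sSup D : Subgroup G) → ∃ K ∈ D, (S : Set G) ⊆ K := by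
    intro S
    induction S using Finset.induction with
    | empty => exact fun _ => ⟨_, hne.some_mem, by simp⟩
    | insert a S _ ih =>
      intro h
      rw [Finset.coe_insert, Set.insert_subset_iff] at h
      obtain ⟨K, hK, hSK⟩ := ih h.2
      obtain ⟨K', hK', haK'⟩ := (mem_sSup_of_directedOn hne hD).1 h.1
      obtain ⟨L, hL, h1, h2⟩ := hD K hK K' hK'
      refine ⟨L, hL, ?_⟩
      rw [Finset.coe_insert, Set.insert_subset_iff]
      exact ⟨h2 haK', hSK.trans h1⟩
  obtain ⟨K, hK, h⟩ := this S hle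
  exact ⟨K, hK, (closure_le K).2 h⟩

theorem LocFinByNil.sSup {D : Set (Subgroup G)} (hne : D.Nonempty)
    (hD : DirectedOn (· ≤ ·) D) (h : ∀ K ∈ D, LocFinByNil K) : LocFinByNil (sSup D) := by
  intro M hM hfg
  obtain ⟨K, hK, hMK⟩ := exists_le_of_fg_of_le_sSup hne hD hfg hM
  exact h K hK M hMK hfg

theorem exists_fg_le_sup {H K M : Subgroup G} (hM : M.FG) (hle : M ≤ H ⊔ K) :
    ∃ U ≤ H, ∃ V ≤ K, U.FG ∧ V.FG ∧ M ≤ U ⊔ V := by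
  let D : Set (Subgroup G) := {Q | ∃ U ≤ H, ∃ V ≤ K, U.FG ∧ V.FG ∧ Q = U ⊔ V}
  have hcyc : ∀ g : G, (zpowers g).FG := fun g =>
    (Subgroup.fg_iff _).2 ⟨{g}, (zpowers_eq_closure g).symm, Set.finite_singleton g⟩
  have hne : D.Nonempty := ⟨⊥, ⊥, bot_le, ⊥, bot_le, FG.bot, FG.bot, by simp⟩
  have hD : DirectedOn (· ≤ ·) D := by
    rintro _ ⟨U, hU, V, hV, hUf, hVf, rfl⟩ _ ⟨U', hU', V', hV', hUf', hVf', rfl⟩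
    exact ⟨(U ⊔ U') ⊔ (V ⊔ V'), ⟨_, sup_le hU hU', _, sup_le hV hV', hUf.sup hUf', hVf.sup hVf', rfl⟩,
      sup_le_sup le_sup_left le_sup_left, sup_le_sup le_sup_right le_sup_right⟩
  have hsup : H ⊔ K ≤ sSup D := by
    refine sup_le (fun h hh => ?_) (fun k hk => ?_)
    · have : zpowers h ∈ D := ⟨zpowers h, by simpa using hh, ⊥, bot_le, hcyc h, FG.bot, by simp⟩
      exact le_sSup this (mem_zpowers h)
    · have : zpowers k ∈ D := ⟨⊥, bot_le, zpowers k, by simpa using hk, FG.bot, hcyc k, by simp⟩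
      exact le_sSup this (mem_zpowers k)
  obtain ⟨_, ⟨U, hU, V, hV, hUf, hVf, rfl⟩, h⟩ :=
    exists_le_of_fg_of_le_sSup hne hD hM (hle.trans hsup)
  exact ⟨U, hU, V, hV, hUf, hVf, h⟩

/-- The step of the Hirsch–Plotkin theorem that uses the maximal condition: `⟨V, V^U⟩` is finitely
generated. With `C` the set of commutators of generators of `U` and `V`, it is generated by `V` and
the `U`-closure of `C`, which lies in the finitely generated subgroup `⟨U, C⟩` of `H`. -/
theorem exists_fg_normalized {H K U V : Subgroup G} (hHK : H ≤ normalizer (K : Set G))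
    (hKH : K ≤ normalizer (H : Set G)) (hH : LocFinByNil H) (hU : U ≤ H) (hV : V ≤ K)
    (hUf : U.FG) (hVf : V.FG) :
    ∃ Q, V ≤ Q ∧ Q ≤ K ∧ Q ≤ U ⊔ V ∧ Q.FG ∧ U ≤ normalizer (Q : Set G) := by
  obtain ⟨X₀, hX₀, hX₀f⟩ := (Subgroup.fg_iff U).1 hUf
  obtain ⟨Y, hY, hYf⟩ := (Subgroup.fg_iff V).1 hVf
  -- a generating set of `U` closed under inversion
  let X : Set G := X₀ ∪ X₀⁻¹
  have hX : closure X = U := by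
    rw [Subgroup.closure_union, closure_inv, sup_idem, hX₀]
  have hXf : X.Finite := hX₀f.union hX₀f.inv
  have hXinv : ∀ x ∈ X, x⁻¹ ∈ X := by
    rintro x (hx | hx)
    · exact Or.inr (by simpa using hx)
    · exact Or.inl hx
  have hXU : X ⊆ U := hX ▸ subset_closure
  have hYV : Y ⊆ V := hY ▸ subset_closure
  let C : Set G := Set.image2 (fun x y => ⁅x, y⁆) X Y
  have hCf : C.Finite := hXf.image2 _ hYf
  have hCH : C ⊆ H := by
    rintro _ ⟨x, hx, y, hy, rfl⟩
    exact le_normalizer_iff_commutator_le_left.1 hKH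
      (commutator_mem_commutator (hU (hXU hx)) (hV (hYV hy)))
  have hCK : C ⊆ K := by
    rintro _ ⟨x, hx, y, hy, rfl⟩
    exact le_normalizer_iff_commutator_le_right.1 hHK
      (commutator_mem_commutator (hU (hXU hx)) (hV (hYV hy)))
  have hCUV : C ⊆ (U ⊔ V : Subgroup G) := by
    rintro _ ⟨x, hx, y, hy, rfl⟩
    exact commutator_le_sup _ _ (commutator_mem_commutator (hXU hx) (hYV hy))
  let E : Set G := Set.image2 (fun u c => u * c * u⁻¹) U C
  have hCE : C ⊆ E := fun c hc => ⟨1, one_mem U, c, hc, by simp⟩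
  have hEfg : (closure E).FG := by
    have hUC : (U ⊔ closure C).FG := hUf.sup ((Subgroup.fg_iff _).2 ⟨C, rfl, hCf⟩)
    refine (hH _ (sup_le hU ((closure_le H).2 hCH)) hUC).fg_of_le hUC ?_
    rw [closure_le]
    rintro _ ⟨u, hu, c, hc, rfl⟩
    exact mul_mem (mul_mem (mem_sup_left hu) (mem_sup_right (subset_closure hc)))
      (inv_mem (mem_sup_left hu))
  have hEK : closure E ≤ K := by
    rw [closure_le]
    rintro _ ⟨u, hu, c, hc, rfl⟩
    exact (mem_normalizer_iff.1 (hHK (hU hu)) c).1 (hCK hc)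
  have hEUV : closure E ≤ U ⊔ V := by
    rw [closure_le]
    rintro _ ⟨u, hu, c, hc, rfl⟩
    exact mul_mem (mul_mem (mem_sup_left hu) (hCUV hc)) (inv_mem (mem_sup_left hu))
  refine ⟨V ⊔ closure E, le_sup_left, sup_le hV hEK, sup_le le_sup_right hEUV, hVf.sup hEfg, ?_⟩
  rw [← hX]
  refine le_normalizer_of_conj_mem hXinv fun x hx => ?_
  have hmap : (V ⊔ closure E).map (MulAut.conj x).toMonoidHom ≤ V ⊔ closure E := by
    rw [Subgroup.map_sup, ← hY, MonoidHom.map_closure, MonoidHom.map_closure, hY]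
    refine sup_le ((closure_le _).2 ?_) ((closure_le _).2 ?_)
    · rintro _ ⟨y, hy, rfl⟩
      have : (MulAut.conj x).toMonoidHom y = ⁅x, y⁆ * y := by simp [commutatorElement_def]
      rw [this]
      exact mul_mem (mem_sup_right (subset_closure (hCE ⟨x, hx, y, hy, rfl⟩)))
        (mem_sup_left (hYV hy))
    · rintro _ ⟨_, ⟨u, hu, c, hc, rfl⟩, rfl⟩
      refine mem_sup_right (subset_closure ⟨x * u, mul_mem (hXU hx) hu, c, hc, ?_⟩)
      simp [mul_assoc]
  exact fun q hq => hmap ⟨q, hq, by simp⟩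

/-- The **Hirsch–Plotkin theorem** for locally finite-by-nilpotent subgroups. -/
theorem LocFinByNil.sup {H K : Subgroup G} (hHK : H ≤ normalizer (K : Set G))
    (hKH : K ≤ normalizer (H : Set G)) (hH : LocFinByNil H) (hK : LocFinByNil K) :
    LocFinByNil (H ⊔ K) := by
  intro M hM hfg
  obtain ⟨U, hU, V, hV, hUf, hVf, hMUV⟩ := exists_fg_le_sup hfg hM
  obtain ⟨Q, hVQ, hQK, hQ, hQf, hUQ⟩ := exists_fg_normalized hHK hKH hH hU hV hUf hVf
  obtain ⟨P, hUP, hPH, hP, hPf, hVP⟩ := exists_fg_normalized hKH hHK hK hV hU hVf hUf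
  rw [sup_comm] at hP
  have hPQ : P ≤ normalizer (Q : Set G) := hP.trans (sup_le hUQ (hVQ.trans le_normalizer))
  have hQP : Q ≤ normalizer (P : Set G) := hQ.trans (sup_le (hUP.trans le_normalizer) hVP)
  exact (FinByNil.sup hPQ hQP (hH P hPH hPf) (hK Q hQK hQf)).mono
    (hMUV.trans (sup_le_sup hUP hVQ))

/-! ### The locally finite-by-nilpotent radical -/

/-- The join of all normal locally finite-by-nilpotent subgroups of `H`. -/
def locRadical (H : Subgroup G) : Subgroup G :=
  sSup {K | K ≤ H ∧ H ≤ normalizer (K : Set G) ∧ LocFinByNil K}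

theorem le_locRadical {H K : Subgroup G} (h₁ : K ≤ H) (h₂ : H ≤ normalizer (K : Set G))
    (h₃ : LocFinByNil K) : K ≤ locRadical H :=
  le_sSup ⟨h₁, h₂, h₃⟩

theorem locRadical_le (H : Subgroup G) : locRadical H ≤ H :=
  sSup_le fun _ h => h.1

theorem locFinByNil_locRadical (H : Subgroup G) : LocFinByNil (locRadical H) := by
  refine LocFinByNil.sSup ?_ ?_ fun K hK => hK.2.2
  · refine ⟨⊥, bot_le, by rw [normalizer_eq_top]; exact le_top, FinByNil.locFinByNil ⟨0, by simp⟩⟩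
  · intro K hK L hL
    refine ⟨K ⊔ L, ⟨sup_le hK.1 hL.1, ?_, ?_⟩, le_sup_left, le_sup_right⟩
    · exact (le_inf hK.2.1 hL.2.1).trans (normalizer_inf_normalizer_le_normalizer_sup K L)
    · exact LocFinByNil.sup (hK.1.trans hL.2.1) (hL.1.trans hK.2.1) hK.2.2 hL.2.2

theorem normalizer_le_normalizer_locRadical (H : Subgroup G) :
    normalizer (H : Set G) ≤ normalizer (locRadical H : Set G) := by
  have hmap : ∀ g ∈ normalizer (H : Set G),
      (locRadical H).map (MulAut.conj g).toMonoidHom ≤ locRadical H := by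
    intro g hg
    have hgH := mem_normalizer_iff_map_conj_eq.1 hg
    rw [map_le_iff_le_comap]
    refine sSup_le fun K hK => map_le_iff_le_comap.1 (le_locRadical ?_ ?_ ?_)
    rotate_right
    · exact hK.2.2.map (MulAut.conj g).injective
    · exact (map_mono hK.1).trans hgH.le
    · have := (map_mono (f := (MulAut.conj g).toMonoidHom) hK.2.1).trans (le_normalizer_map _)
      exact hgH.ge.trans this
  have := le_normalizer_of_conj_mem (X := normalizer (H : Set G)) (Q := locRadical H)
    (fun x hx => inv_mem hx) (fun g hg q hq => hmap g hg ⟨q, hq, by simp⟩)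
  rwa [closure_eq] at this

theorem locRadical_le_of_normal {H K : Subgroup G} (hHK : H ≤ K)
    (hK : K ≤ normalizer (H : Set G)) : locRadical H ≤ locRadical K :=
  le_locRadical ((locRadical_le H).trans hHK) (hK.trans (normalizer_le_normalizer_locRadical H))
    (locFinByNil_locRadical H)

/-- A locally finite-by-nilpotent subgroup containing a term of the lower central series of `C` is
subnormal in `C` through the subgroups `X ⊔ γⱼ(C)`, hence lies in the radical of `C`. -/
theorem le_locRadical_of_lowerCentralSeries_le {C X : Subgroup G} {m : ℕ}
    (hm : C.lowerCentralSeries m ≤ X) (hXC : X ≤ C) (hX : LocFinByNil X) : X ≤ locRadical C := by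
  have key : ∀ j, locRadical (X ⊔ C.lowerCentralSeries j) ≤ locRadical C := by
    intro j
    induction j with
    | zero => simp [hXC]
    | succ j ih =>
      refine (locRadical_le_of_normal ?_ ?_).trans ih
      · exact sup_le_sup_left (C.lowerCentralSeries_antitone (Nat.le_succ j)) X
      · have hC := self_le_normalizer_lowerCentralSeries C (j + 1)
        refine sup_le ((le_inf le_normalizer (hXC.trans hC)).trans
          (normalizer_inf_normalizer_le_normalizer_sup _ _)) ?_
        refine le_normalizer_iff_commutator_le_right.2 (le_sup_right.trans' ?_)
        exact commutator_mono le_rfl (sup_le hXC (lowerCentralSeries_le_self C _))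
  have h := key m
  rw [sup_eq_left.2 hm] at h
  exact (le_locRadical le_rfl le_normalizer hX).trans h

/-! ### Central extensions and torsion -/

/-- The set-theoretic half of Schur's theorem: a commutator depends only on the classes of its
entries modulo the centre. -/
theorem finite_commutatorSet_of_finiteIndex_center [(center G).FiniteIndex] :
    Finite (commutatorSet G) := by
  refine ((Set.finite_range fun p : (G ⧸ center G) × (G ⧸ center G) =>
    ⁅p.1.out, p.2.out⁆).subset ?_).to_subtype
  rintro _ ⟨x, y, rfl⟩
  refine ⟨(x, y), ?_⟩
  obtain ⟨c, hc⟩ := QuotientGroup.mk_out_eq_mul (center G) x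
  obtain ⟨d, hd⟩ := QuotientGroup.mk_out_eq_mul (center G) y
  have hc' := mem_center_iff.1 c.2
  have hd' := mem_center_iff.1 d.2
  simp only [hc, hd, commutatorElement_def, mul_inv_rev]
  calc x * c * (y * d) * ((c : G)⁻¹ * x⁻¹) * ((d : G)⁻¹ * y⁻¹)
      = x * (c * (y * d)) * ((c : G)⁻¹ * x⁻¹) * ((d : G)⁻¹ * y⁻¹) := by group
    _ = x * (y * d * c) * ((c : G)⁻¹ * x⁻¹) * ((d : G)⁻¹ * y⁻¹) := by rw [hc']
    _ = x * y * (d * x⁻¹) * ((d : G)⁻¹ * y⁻¹) := by group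
    _ = x * y * (x⁻¹ * d) * ((d : G)⁻¹ * y⁻¹) := by rw [hd']
    _ = x * y * x⁻¹ * y⁻¹ := by group

theorem finite_of_isMulCommutative_of_torsion [IsMulCommutative G] {S : Set G} (hS : S.Finite)
    (hgen : closure S = ⊤) (h : ∀ s ∈ S, IsOfFinOrder s) : Finite G := by
  let _ : CommGroup G := { (inferInstance : Group G) with mul_comm := mul_comm' }
  have : Group.FG G := Group.fg_iff.2 ⟨S, hgen, hS⟩
  refine CommGroup.finite_of_fg_isMulTorsion G fun g => ?_
  have hle : closure S ≤ CommGroup.torsion G := (closure_le _).2 h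
  exact hle (hgen ▸ mem_top g)

theorem finite_of_isNilpotent_of_torsion [Group.IsNilpotent G] {S : Set G} (hS : S.Finite)
    (hgen : closure S = ⊤) (h : ∀ s ∈ S, IsOfFinOrder s) : Finite G := by
  let P : ∀ (Q : Type _) [Group Q] [Group.IsNilpotent Q], Prop := fun Q _ _ =>
    ∀ S : Set Q, S.Finite → closure S = ⊤ → (∀ s ∈ S, IsOfFinOrder s) → Finite Q
  refine Group.nilpotent_center_quotient_ind (P := P) G ?_ ?_ S hS hgen h
  · intro Q _ _ S _ _ _
    infer_instance
  · intro Q _ _ ih S hS hgen h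
    have himage : ∀ (N : Subgroup Q) [N.Normal],
        closure (QuotientGroup.mk' N '' S) = ⊤ ∧
          ∀ s ∈ QuotientGroup.mk' N '' S, IsOfFinOrder s := by
      intro N _
      refine ⟨?_, ?_⟩
      · rw [← MonoidHom.map_closure, hgen, map_top_of_surjective _ (QuotientGroup.mk'_surjective N)]
      · rintro _ ⟨s, hs, rfl⟩
        exact (QuotientGroup.mk' N).isOfFinOrder (h s hs)
    have hfin : Finite (Q ⧸ center Q) :=
      ih _ (hS.image _) (himage _).1 (himage _).2
    have : (center Q).FiniteIndex := finiteIndex_of_finite_quotient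
    have : Finite (commutatorSet Q) := finite_commutatorSet_of_finiteIndex_center
    have : IsMulCommutative (Q ⧸ _root_.commutator Q) :=
      ⟨⟨fun a b => mul_comm (G := Abelianization Q) a b⟩⟩
    have : Finite (Q ⧸ _root_.commutator Q) :=
      finite_of_isMulCommutative_of_torsion (hS.image _) (himage _).1 (himage _).2
    exact Finite.of_subgroup_quotient (_root_.commutator Q)

theorem exists_finite_torsion_subgroup {A : Subgroup G} [A.Normal] (hA : ⁅A, A⁆ = ⊥)
    (hfg : A.FG) : ∃ T : Subgroup G, T.Normal ∧ (T : Set G).Finite ∧ T ≤ A ∧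
      ∀ x, x ∈ T ↔ x ∈ A ∧ IsOfFinOrder x := by
  have hc : IsMulCommutative A := commutator_self_eq_bot_iff.1 hA
  let T : Subgroup G :=
    { carrier := {x | x ∈ A ∧ IsOfFinOrder x}
      one_mem' := ⟨one_mem A, IsOfFinOrder.one⟩
      mul_mem' := fun {x y} hx hy => ⟨mul_mem hx.1 hy.1,
        Commute.isOfFinOrder_mul (setLike_mul_comm hx.1 hy.1) hx.2 hy.2⟩
      inv_mem' := fun {x} hx => ⟨inv_mem hx.1, hx.2.inv⟩ }
  have hTA : T ≤ A := fun x hx => hx.1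
  refine ⟨T, ⟨fun x hx g => ⟨Normal.conj_mem inferInstance x hx.1 g, ?_⟩⟩, ?_, hTA,
    fun x => Iff.rfl⟩
  · exact (MulAut.conj g).toMonoidHom.isOfFinOrder hx.2
  · have hT : ⁅T, T⁆ = ⊥ := by rw [eq_bot_iff, ← hA]; exact commutator_mono hTA hTA
    have : IsMulCommutative T := commutator_self_eq_bot_iff.1 hT
    have hTf : Group.FG T :=
      (Group.fg_iff_subgroup_fg T).2 (fg_of_le_of_commutator_eq_bot hA hfg hTA)
    obtain ⟨S, hS, hSf⟩ := Group.fg_iff.1 hTf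
    have : Finite T := finite_of_isMulCommutative_of_torsion hSf hS fun s _ =>
      (Submonoid.isOfFinOrder_coe (H := T.toSubmonoid)).1 s.2.2
    exact Set.toFinite _

/-- A central extension of a finite-by-nilpotent group by a finitely generated group is
finite-by-nilpotent. If `γₙ(G / A)` is finite then `K = γₙ(G) A` is centre-by-finite, so that it has
finite derived subgroup by Schur's theorem; and once `K` is abelian, the commutators `⁅x, g⁆` with
`x` in `K` are torsion since some power of `x` is central. -/
theorem finByNil_top_of_le_center {A : Subgroup G} [A.Normal] (hA : A ≤ center G) (hfg : A.FG)
    (h : FinByNil (⊤ : Subgroup (G ⧸ A))) : FinByNil (⊤ : Subgroup G) := by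
  obtain ⟨n, hn⟩ := h
  let K : Subgroup G := (⊤ : Subgroup G).lowerCentralSeries n ⊔ A
  let f := QuotientGroup.mk' A
  have hKf : K.map f = (⊤ : Subgroup (G ⧸ A)).lowerCentralSeries n := by
    have : A.map f = ⊥ := by rw [Subgroup.map_eq_bot_iff, QuotientGroup.ker_mk']
    rw [Subgroup.map_sup, this, sup_bot_eq, map_lowerCentralSeries,
      map_top_of_surjective _ (QuotientGroup.mk'_surjective A)]
  have hKfin : Finite (K.map f) := by rw [hKf]; exact hn.to_subtype
  have hKfg : K.FG := by
    refine fg_of_fg_map_of_fg_inf_ker f ((Group.fg_iff_subgroup_fg _).1 inferInstance) ?_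
    rw [QuotientGroup.ker_mk', inf_eq_right.2 (le_sup_right : A ≤ K)]
    exact hfg
  let fK : K →* G ⧸ A := f.comp K.subtype
  have : Finite fK.range := by
    rw [MonoidHom.range_comp, range_subtype]; exact hKfin
  have hker : ∀ x : K, x ∈ fK.ker ↔ (x : G) ∈ A := fun x => by
    rw [MonoidHom.mem_ker, MonoidHom.comp_apply, ← MonoidHom.mem_ker, QuotientGroup.ker_mk']; rfl
  have : (center K).FiniteIndex := by
    refine finiteIndex_of_le (H := fK.ker) fun x hx => mem_center_iff.2 fun y => ?_
    exact Subtype.ext (mem_center_iff.1 (hA ((hker x).1 hx)) y)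
  have := finite_commutatorSet_of_finiteIndex_center (G := K)
  let D : Subgroup G := ⁅K, K⁆
  have hD : (D : Set G).Finite := by
    have hDK : D = (_root_.commutator K).map K.subtype := by
      rw [_root_.commutator_def, map_commutator, ← MonoidHom.range_eq_map, range_subtype]
    rw [hDK, coe_map]
    have : Finite (_root_.commutator K) := inferInstance
    exact Set.Finite.image _ (Set.toFinite (_root_.commutator K : Set K))
  refine FinByNil.of_quotient hD ?_
  let q := QuotientGroup.mk' D
  have hq : Function.Surjective q := QuotientGroup.mk'_surjective D
  let K₁ := K.map q
  have hK₁n : K₁.Normal := Normal.map inferInstance q hq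
  have hK₁ : ⁅K₁, K₁⁆ = ⊥ := by
    rw [← map_commutator, Subgroup.map_eq_bot_iff, QuotientGroup.ker_mk']
  obtain ⟨T, hTn, hTf, -, hT⟩ := exists_finite_torsion_subgroup hK₁ (fg_map hKfg q)
  refine ⟨n + 1, hTf.subset ?_⟩
  have hle : (⊤ : Subgroup (G ⧸ D)).lowerCentralSeries n ≤ K₁ := by
    rw [← map_top_of_surjective q hq, ← map_lowerCentralSeries]
    exact map_mono le_sup_left
  refine (commutator_mono hle le_rfl).trans (commutator_le.2 ?_)
  rintro _ ⟨x, hx, rfl⟩ g -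
  obtain ⟨g, rfl⟩ := hq g
  have hy : q (g * x⁻¹ * g⁻¹) ∈ K₁ :=
    mem_map_of_mem q (Normal.conj_mem inferInstance _ (inv_mem hx) g)
  have hmul : ⁅q x, q g⁆ = q x * q (g * x⁻¹ * g⁻¹) := by
    simp [commutatorElement_def, mul_assoc]
  have hcomm : Commute (q x) (q (g * x⁻¹ * g⁻¹)) := by
    have : IsMulCommutative K₁ := commutator_self_eq_bot_iff.1 hK₁
    exact setLike_mul_comm (mem_map_of_mem q hx) hy
  rw [hT]
  refine ⟨hmul ▸ mul_mem (mem_map_of_mem q hx) hy, isOfFinOrder_iff_pow_eq_one.2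
    ⟨fK.ker.index, Nat.pos_of_ne_zero FiniteIndex.index_ne_zero, ?_⟩⟩
  have hxA : x ^ fK.ker.index ∈ A := by
    have := (hker _).1 (fK.ker.pow_index_mem ⟨x, hx⟩)
    simpa using this
  have hz := mem_center_iff.1 (inv_mem (hA hxA)) g
  rw [hmul, hcomm.mul_pow, ← map_pow, ← map_pow, ← map_mul, conj_pow, inv_pow, hz]
  simp

/-! ### Almost Engel elements acting on abelian normal subgroups -/

theorem map_iterComm {G' : Type*} [Group G'] (f : G →* G') (x g : G) (n : ℕ) :
    f (iterComm x g n) = iterComm (f x) (f g) n := by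
  induction n with
  | zero => rfl
  | succ n ih => simp [iterComm, ih]

theorem IsAlmostEngel.map {G' : Type*} [Group G'] {f : G →* G'} (hf : Function.Surjective f)
    {g : G} (hg : IsAlmostEngel g) : IsAlmostEngel (f g) := by
  obtain ⟨E, hE, h⟩ := hg
  refine ⟨f '' E, hE.image f, fun y => ?_⟩
  obtain ⟨x, rfl⟩ := hf y
  obtain ⟨n₀, hn₀, hx⟩ := h x
  exact ⟨n₀, hn₀, fun n hn => ⟨_, hx n hn, map_iterComm f x g n⟩⟩

/-- The endomorphism `x ↦ [x, a] = x⁻¹a⁻¹xa` of an abelian normal subgroup. In terms of Mathlib's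
`⁅g, h⁆ = ghg⁻¹h⁻¹` it is `x ↦ ⁅x⁻¹, a⁻¹⁆`. -/
def commHom (A : Subgroup G) [A.Normal] [IsMulCommutative A] (a : G) : A →* A where
  toFun x := x⁻¹ * MulAut.conjNormal a⁻¹ x
  map_one' := by simp
  map_mul' x y := by
    rw [map_mul, mul_inv_rev, mul_comm' y⁻¹ x⁻¹, mul_assoc, mul_assoc, ← mul_assoc y⁻¹,
      mul_comm' y⁻¹]
    simp only [mul_assoc]

/-- The subgroup of periodic points of an endomorphism. -/
def periodicSubgroup {M : Type*} [Group M] (φ : M →* M) : Subgroup M where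
  carrier := Function.periodicPts φ
  one_mem' := ⟨1, one_pos, map_one φ⟩
  mul_mem' := by
    rintro x y ⟨p, hp, hx⟩ ⟨q, hq, hy⟩
    refine ⟨p * q, Nat.mul_pos hp hq, ?_⟩
    rw [Function.IsPeriodicPt, Function.IsFixedPt, iterate_map_mul, (hx.mul_const q).eq,
      (hy.const_mul p).eq]
  inv_mem' := by
    rintro x ⟨p, hp, hx⟩
    refine ⟨p, hp, ?_⟩
    rw [Function.IsPeriodicPt, Function.IsFixedPt, iterate_map_inv, hx.eq]

/-- The elements that `n` applications of `φ` make periodic. -/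
def periodicLevel {M : Type*} [Group M] (φ : M →* M) : ℕ → Subgroup M
  | 0 => periodicSubgroup φ
  | n + 1 => (periodicLevel φ n).comap φ

theorem periodicLevel_mono {M : Type*} [Group M] (φ : M →* M) : Monotone (periodicLevel φ) := by
  refine monotone_nat_of_le_succ fun n => ?_
  induction n with
  | zero =>
    rintro x ⟨p, hp, hx⟩
    exact ⟨p, hp, hx.map (Function.Commute.refl φ)⟩
  | succ n ih => exact comap_mono ih

theorem mem_periodicLevel {M : Type*} [Group M] {φ : M →* M} {n : ℕ} {x : M} :
    x ∈ periodicLevel φ n ↔ φ^[n] x ∈ periodicSubgroup φ := by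
  induction n generalizing x with
  | zero => rfl
  | succ n ih => rw [Function.iterate_succ_apply, ← ih]; rfl

theorem coe_commHom_iterate {A : Subgroup G} [A.Normal] [IsMulCommutative A] (a : G) (x : A)
    (n : ℕ) : (((commHom A a)^[n] x : A) : G) = iterComm (x : G) a n := by
  induction n with
  | zero => rfl
  | succ n ih =>
    rw [Function.iterate_succ_apply', iterComm, ← ih]
    simp [commHom, mul_assoc]

/-- Iterates of `x ↦ [x, a]` eventually stay in a finite set, so they become periodic. -/
theorem exists_mem_periodicLevel {A : Subgroup G} [A.Normal] [IsMulCommutative A] {a : G}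
    (ha : IsAlmostEngel a) (x : A) : ∃ n, x ∈ periodicLevel (commHom A a) n := by
  obtain ⟨E, hE, h⟩ := ha
  obtain ⟨n₀, -, hx⟩ := h x
  set φ := commHom A a
  have hmem : ∀ n, n₀ ≤ n → φ^[n] x ∈ ((↑) ⁻¹' E : Set A) := fun n hn => by
    rw [Set.mem_preimage, coe_commHom_iterate]; exact hx n hn
  have hfin : ((↑) ⁻¹' E : Set A).Finite := hE.preimage Subtype.val_injective.injOn
  obtain ⟨i, hi, j, hj, hij, heq⟩ := (Set.Ici_infinite n₀).exists_lt_map_eq_of_mapsTo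
    (f := fun n => φ^[n] x) (fun n hn => hmem n hn) hfin
  refine ⟨i, mem_periodicLevel.2 ⟨j - i, by omega, ?_⟩⟩
  rw [Function.IsPeriodicPt, Function.IsFixedPt, ← Function.iterate_add_apply,
    Nat.sub_add_cancel hij.le]
  exact heq.symm

theorem finite_periodicSubgroup {A : Subgroup G} [A.Normal] [IsMulCommutative A] {a : G}
    (ha : IsAlmostEngel a) : (periodicSubgroup (commHom A a) : Set A).Finite := by
  obtain ⟨E, hE, h⟩ := ha
  refine (hE.preimage (f := ((↑) : A → G)) Subtype.val_injective.injOn).subset ?_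
  rintro x ⟨p, hp, hx⟩
  obtain ⟨n₀, -, hxE⟩ := h x
  have := hxE (p * n₀) (Nat.le_mul_of_pos_left n₀ hp)
  rw [← coe_commHom_iterate, (hx.mul_const n₀).eq] at this
  exact this

theorem conjNormal_mem_periodicLevel {A : Subgroup G} [A.Normal] [IsMulCommutative A] {a : G}
    {n : ℕ} {x : A} (b : G) (hb : Commute b a) (hx : x ∈ periodicLevel (commHom A a) n) :
    MulAut.conjNormal b x ∈ periodicLevel (commHom A a) n := by
  have hcomm : Function.Commute (MulAut.conjNormal b : MulAut A) (commHom A a) := by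
    intro x
    simp only [commHom, MonoidHom.coe_mk, OneHom.coe_mk, map_mul, map_inv]
    congr 1
    rw [← map_inv, ← MulAut.mul_apply, ← MulAut.mul_apply, ← map_mul, ← map_mul,
      (hb.inv_right).eq]
  obtain ⟨p, hp, hx⟩ := mem_periodicLevel.1 hx
  refine mem_periodicLevel.2 ⟨p, hp, ?_⟩
  rw [← (hcomm.iterate_right n).eq x]
  exact hx.map hcomm

section Levels

variable (A : Subgroup G) [A.Normal] [IsMulCommutative A] (a : G)

/-- The subgroup `periodicLevel (commHom A a) n`, viewed inside the ambient group. -/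
def engelLevel (n : ℕ) : Subgroup G :=
  (periodicLevel (commHom A a) n).map A.subtype

theorem engelLevel_le (n : ℕ) : engelLevel A a n ≤ A := map_subtype_le _

theorem zpowers_le_normalizer_engelLevel (n : ℕ) :
    zpowers a ≤ normalizer (engelLevel A a n : Set G) := by
  have := le_normalizer_of_conj_mem (X := (zpowers a : Set G)) (Q := engelLevel A a n)
    (fun x hx => inv_mem hx) ?_
  · rwa [closure_eq] at this
  · rintro b hb _ ⟨x, hx, rfl⟩
    obtain ⟨k, rfl⟩ := mem_zpowers_iff.1 hb
    exact ⟨_, conjNormal_mem_periodicLevel (a ^ k) ((Commute.refl a).zpow_left k) hx,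
      MulAut.conjNormal_apply _ _⟩

theorem le_normalizer_engelLevel (n : ℕ) : A ≤ normalizer (engelLevel A a n : Set G) := by
  refine le_normalizer_iff_commutator_le_right.2 ?_
  have : ⁅A, engelLevel A a n⁆ ≤ ⁅A, A⁆ := commutator_mono le_rfl (engelLevel_le A a n)
  rw [commutator_self_eq_bot_iff.2 inferInstance] at this
  exact this.trans bot_le

theorem commutator_engelLevel_succ_le (n : ℕ) :
    ⁅engelLevel A a (n + 1), A ⊔ zpowers a⁆ ≤ engelLevel A a n := by
  refine commutator_sup_right_le (le_normalizer_engelLevel A a n)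
    (zpowers_le_normalizer_engelLevel A a n)
    ((engelLevel_le A a _).trans (le_normalizer_engelLevel A a n)) ?_ ?_
  · have : ⁅engelLevel A a (n + 1), A⁆ ≤ ⁅A, A⁆ := commutator_mono (engelLevel_le A a _) le_rfl
    rw [commutator_self_eq_bot_iff.2 inferInstance] at this
    exact this.trans bot_le
  · rw [← zpowers_inv, zpowers_eq_closure, ← closure_eq (engelLevel A a (n + 1))]
    refine commutator_closure_le ((engelLevel_le A a _).trans (le_normalizer_engelLevel A a n)) ?_ ?_
    · rw [Set.singleton_subset_iff]
      exact zpowers_le_normalizer_engelLevel A a n (inv_mem (mem_zpowers a))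
    · rintro _ ⟨x, hx, rfl⟩ _ rfl
      have hx' : x⁻¹ ∈ periodicLevel (commHom A a) (n + 1) := inv_mem hx
      refine ⟨commHom A a x⁻¹, hx', ?_⟩
      change (((x⁻¹)⁻¹ * MulAut.conjNormal a⁻¹ x⁻¹ : A) : G) = ⁅(x : G), a⁻¹⁆
      rw [inv_inv, coe_mul, MulAut.conjNormal_apply, commutatorElement_def, InvMemClass.coe_inv]
      simp only [mul_assoc]

variable {a}

/-- For `K = engelLevel A a n ⊔ ⟨a⟩`, the descending chain `K`, `engelLevel A a n`,
`engelLevel A a (n - 1)`, … is central in `K` and reaches the finite group `engelLevel A a 0`. -/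
theorem finByNil_engelLevel_sup_zpowers (ha : IsAlmostEngel a) (n : ℕ) :
    FinByNil (engelLevel A a n ⊔ zpowers a) := by
  set K := engelLevel A a n ⊔ zpowers a with hK
  have hKA : K ≤ A ⊔ zpowers a := sup_le_sup_right (engelLevel_le A a n) _
  have hKn : ∀ m, K ≤ normalizer (engelLevel A a m : Set G) := fun m =>
    hKA.trans (sup_le (le_normalizer_engelLevel A a m) (zpowers_le_normalizer_engelLevel A a m))
  have hself : ∀ m, ⁅engelLevel A a m, K⁆ ≤ engelLevel A a m := fun m =>
    le_normalizer_iff_commutator_le_left.1 (hKn m)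
  let D : ℕ → Subgroup G
    | 0 => K
    | i + 1 => engelLevel A a (n - i)
  refine ⟨n + 1, Set.Finite.subset ?_ (lowerCentralSeries_le_of_commutator_le
    (D := D) le_rfl (fun i => ?_) (n + 1))⟩
  · simp only [D, Nat.sub_self]
    exact (finite_periodicSubgroup ha).image _
  · cases i with
    | zero =>
      refine commutator_sup_left_le le_normalizer (le_sup_right.trans (hKn n)) (hKn n) (hself n) ?_
      refine commutator_sup_right_le le_normalizer (le_sup_right.trans (hKn n))
        (le_sup_right.trans (hKn n)) ?_ ?_
      · exact le_normalizer_iff_commutator_le_right.1 (zpowers_le_normalizer_engelLevel A a n)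
      · rw [commutator_self_eq_bot_iff.2 inferInstance]; exact bot_le
    | succ i =>
      simp only [D]
      rcases Nat.eq_zero_or_pos (n - i) with h | h
      · rw [show n - (i + 1) = n - i by omega]
        exact hself _
      · rw [show n - i = n - (i + 1) + 1 by omega]
        exact (commutator_mono le_rfl hKA).trans (commutator_engelLevel_succ_le A a _)

/-- If `a` is almost Engel then `A⟨a⟩` is the union of the finite-by-nilpotent subgroups
`engelLevel A a n ⊔ ⟨a⟩`. -/
theorem locFinByNil_sup_zpowers (ha : IsAlmostEngel a) : LocFinByNil (A ⊔ zpowers a) := by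
  have hmono : Monotone fun n => engelLevel A a n ⊔ zpowers a := fun m n hmn =>
    sup_le_sup_right (map_mono (periodicLevel_mono _ hmn)) _
  refine LocFinByNil.mono (LocFinByNil.sSup (Set.range_nonempty _)
    hmono.directed_le.directedOn_range ?_) (sup_le (fun x hx => ?_) ?_)
  · rintro _ ⟨n, rfl⟩
    exact (finByNil_engelLevel_sup_zpowers A ha n).locFinByNil
  · obtain ⟨n, hn⟩ := exists_mem_periodicLevel ha (⟨x, hx⟩ : A)
    have hle := le_sSup (Set.mem_range_self (f := fun n => engelLevel A a n ⊔ zpowers a) n)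
    exact hle (mem_sup_left ⟨_, hn, rfl⟩)
  · exact le_sup_right.trans
      (le_sSup (Set.mem_range_self (f := fun n => engelLevel A a n ⊔ zpowers a) 0))

end Levels

/-! ### Quotients of finite-by-nilpotent groups -/

theorem FinByNil.top_of_surjective {G' : Type*} [Group G'] {f : G →* G'}
    (hf : Function.Surjective f) (h : FinByNil (⊤ : Subgroup G)) :
    FinByNil (⊤ : Subgroup G') := by
  rw [← map_top_of_surjective f hf]; exact h.map f

theorem finiteIndex_map {G' : Type*} [Group G'] {f : G →* G'} (hf : Function.Surjective f)
    (H : Subgroup G) [H.FiniteIndex] : (H.map f).FiniteIndex :=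
  ⟨fun h => FiniteIndex.index_ne_zero (H := H)
    (Nat.eq_zero_of_zero_dvd (h ▸ H.index_map_dvd hf))⟩

theorem finByNil_top_of_finiteIndex_bot [(⊥ : Subgroup G).FiniteIndex] :
    FinByNil (⊤ : Subgroup G) := by
  have : Finite G := Finite.of_subgroup_quotient (⊥ : Subgroup G)
  exact ⟨0, Set.toFinite _⟩

theorem finite_of_finByNil_of_torsion (hG : FinByNil (⊤ : Subgroup G)) {S : Set G}
    (hS : S.Finite) (hgen : closure S = ⊤) (h : ∀ s ∈ S, IsOfFinOrder s) : Finite G := by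
  obtain ⟨N, _, hN, _⟩ := hG.isFiniteByNilpotent
  have hsurj := QuotientGroup.mk'_surjective N
  have : Finite (G ⧸ N) := by
    refine finite_of_isNilpotent_of_torsion (hS.image (QuotientGroup.mk' N)) ?_ ?_
    · rw [← MonoidHom.map_closure, hgen, map_top_of_surjective _ hsurj]
    · rintro _ ⟨s, hs, rfl⟩
      exact (QuotientGroup.mk' N).isOfFinOrder (h s hs)
  exact Finite.of_subgroup_quotient N

/-! ### Almost Engel elements with a power centralising an abelian normal subgroup -/

/-- If `φ : x ↦ [x, a]` kills `φ z`, then conjugation by `aⁱ` multiplies `z` by `(φ z)ⁱ`; so if a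
positive power of `a` centralises `A`, then `φ z` is torsion. -/
theorem commHom_pow_eq_one {A : Subgroup G} [A.Normal] [IsMulCommutative A] {a : G} {k : ℕ}
    (hk : ∀ x ∈ A, Commute (a ^ k) x) {z : A} (hz : commHom A a (commHom A a z) = 1) :
    commHom A a z ^ k = 1 := by
  set c := commHom A a z with hc
  have h1 : MulAut.conjNormal a⁻¹ z = z * c := by simp [hc, commHom]
  have h2 : MulAut.conjNormal a⁻¹ c = c := by
    have : c⁻¹ * MulAut.conjNormal a⁻¹ c = 1 := hz
    exact (inv_mul_eq_one.1 this).symm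
  have h3 : ∀ i : ℕ, MulAut.conjNormal (a⁻¹ ^ i) z = z * c ^ i := by
    intro i
    induction i with
    | zero => simp
    | succ i ih =>
      rw [pow_succ', map_mul, MulAut.mul_apply, ih, map_mul, map_pow, h1, h2, pow_succ', mul_assoc]
  have h4 : MulAut.conjNormal (a⁻¹ ^ k) z = z := by
    apply Subtype.ext
    rw [MulAut.conjNormal_apply, inv_pow, inv_inv, mul_assoc, ← (hk z z.2).eq,
      inv_mul_cancel_left]
  rw [h3] at h4
  exact mul_eq_left.1 h4

/-- An almost Engel element with a positive power centralising `A` centralises `A` up to torsion: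
an automorphism of finite order that is unipotent modulo torsion is trivial modulo torsion. -/
theorem isOfFinOrder_commHom {A : Subgroup G} [A.Normal] [IsMulCommutative A] {a : G}
    (ha : IsAlmostEngel a) {k : ℕ} (hk₀ : 0 < k) (hk : ∀ x ∈ A, Commute (a ^ k) x) (x : A) :
    IsOfFinOrder (commHom A a x) := by
  have key : ∀ y, IsOfFinOrder (commHom A a (commHom A a y)) → IsOfFinOrder (commHom A a y) := by
    intro y hy
    obtain ⟨m, hm, hy⟩ := isOfFinOrder_iff_pow_eq_one.1 hy
    have hz := commHom_pow_eq_one hk (z := y ^ m) (by rw [map_pow, map_pow, hy])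
    rw [map_pow, ← pow_mul] at hz
    exact isOfFinOrder_iff_pow_eq_one.2 ⟨m * k, Nat.mul_pos hm hk₀, hz⟩
  have hiter : ∀ n y, IsOfFinOrder ((commHom A a)^[n + 1] y) → IsOfFinOrder (commHom A a y) := by
    intro n
    induction n with
    | zero => exact fun y hy => hy
    | succ n ih => exact fun y hy => key y (ih _ hy)
  have hper : ∀ y ∈ periodicSubgroup (commHom A a), IsOfFinOrder y := by
    intro y hy
    have := (finite_periodicSubgroup (A := A) ha).to_subtype
    exact (periodicSubgroup (commHom A a)).subtype.isOfFinOrder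
      (isOfFinOrder_of_finite (⟨y, hy⟩ : periodicSubgroup (commHom A a)))
  obtain ⟨n, hn⟩ := exists_mem_periodicLevel ha x
  exact hiter n x (hper _ (mem_periodicLevel.1 (periodicLevel_mono _ (Nat.le_succ n) hn)))

/-! ### Reduction along normal subgroups -/

/-- Passing to the quotient by `T` makes `A` central. -/
theorem finByNil_top_of_commutator_le {A T : Subgroup G} [A.Normal] [T.Normal]
    (hT : (T : Set G).Finite) (hAT : ⁅A, ⊤⁆ ≤ T) (hfg : A.FG)
    (h : FinByNil (⊤ : Subgroup (G ⧸ A))) : FinByNil (⊤ : Subgroup G) := by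
  refine FinByNil.of_quotient hT ?_
  let q := QuotientGroup.mk' T
  have hq : Function.Surjective q := QuotientGroup.mk'_surjective T
  have hn : (A.map q).Normal := Normal.map inferInstance q hq
  refine finByNil_top_of_le_center (A := A.map q) ?_ (fg_map hfg q) ?_
  · rw [← commutator_top_right_eq_bot_iff_le_center, ← map_top_of_surjective q hq,
      ← map_commutator, Subgroup.map_eq_bot_iff, QuotientGroup.ker_mk']
    exact hAT
  · let r := (QuotientGroup.mk' (A.map q)).comp q
    have hr : Function.Surjective r := (QuotientGroup.mk'_surjective _).comp hq
    have hA : A ≤ r.ker := fun x hx => by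
      rw [MonoidHom.mem_ker, MonoidHom.comp_apply, ← MonoidHom.mem_ker, QuotientGroup.ker_mk']
      exact mem_map_of_mem q hx
    exact h.top_of_surjective (QuotientGroup.lift_surjective_of_surjective A r hr hA)

theorem closure_image_mk'_eq_top (N : Subgroup G) [N.Normal] {S : Set G} (hgen : closure S = ⊤) :
    closure (QuotientGroup.mk' N '' S) = ⊤ := by
  rw [← MonoidHom.map_closure, hgen, map_top_of_surjective _ (QuotientGroup.mk'_surjective N)]

theorem isAlmostEngel_image_mk' (N : Subgroup G) [N.Normal] {S : Set G}
    (h : ∀ a ∈ S, IsAlmostEngel a) : ∀ a ∈ QuotientGroup.mk' N '' S, IsAlmostEngel a := by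
  rintro _ ⟨a, ha, rfl⟩
  exact (h a ha).map (QuotientGroup.mk'_surjective N)

end

/-! ### Virtually nilpotent and virtually soluble groups -/

universe u

/-- The virtually nilpotent case. With `A` the last nontrivial term of the lower central series of
`R`, a power of every generator lies in `R` and so centralises `A`; hence each generator centralises
`A` modulo its finite torsion subgroup, and `G` is essentially a central extension of `G / A`. -/
theorem finByNil_top_of_nilpotent_finiteIndex (n : ℕ) : ∀ {G : Type u} [Group G]
    (R : Subgroup G) [R.Normal] [R.FiniteIndex], R.lowerCentralSeries n = ⊥ →
    ∀ S : Set G, S.Finite → closure S = ⊤ → (∀ a ∈ S, IsAlmostEngel a) →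
    FinByNil (⊤ : Subgroup G) := by
  induction n with
  | zero =>
    intro G _ R _ hRf hR S _ _ _
    rw [Subgroup.lowerCentralSeries_zero] at hR
    rw [hR] at hRf
    exact finByNil_top_of_finiteIndex_bot
  | succ n ih =>
    intro G _ R _ _ hR S hS hgen hE
    set A := R.lowerCentralSeries n with hA
    have hAR : A ≤ R := lowerCentralSeries_le_self R n
    have hAR0 : ⁅A, R⁆ = ⊥ := hR
    have hAA : ⁅A, A⁆ = ⊥ := le_bot_iff.1 ((commutator_mono le_rfl hAR).trans hAR0.le)
    have : IsMulCommutative A := commutator_self_eq_bot_iff.1 hAA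
    have : Group.FG G := Group.fg_iff.2 ⟨S, hgen, hS⟩
    have hRfg : R.FG := (Group.fg_iff_subgroup_fg R).1 inferInstance
    have hRF : FinByNil R := ⟨n + 1, by rw [hR]; simp⟩
    have hAfg : A.FG := hRF.fg_of_le hRfg hAR
    obtain ⟨T, hTn, hTf, -, hT⟩ := exists_finite_torsion_subgroup hAA hAfg
    have hAT : ⁅A, ⊤⁆ ≤ T := by
      have hnorm : ∀ Z : Set G, Z ⊆ normalizer (T : Set G) := fun Z z _ => by
        rw [normalizer_eq_top]; trivial
      -- `commHom` conjugates by `a⁻¹`, so the inverses of the generators are used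
      rw [← hgen, ← closure_inv, ← closure_eq A]
      refine commutator_closure_le (hnorm _) (hnorm _) fun x hx b hb => ?_
      have hcent : ∀ y ∈ A, Commute (b⁻¹ ^ R.index) y := fun y hy =>
        (mem_centralizer_iff.1 (commutator_eq_bot_iff_le_centralizer.1 hAR0 hy) _
          (R.pow_index_mem b⁻¹))
      have htor := isOfFinOrder_commHom (hE _ hb)
        (Nat.pos_of_ne_zero FiniteIndex.index_ne_zero) hcent (⟨x, hx⟩⁻¹ : A)
      have heq : ⁅x, b⁆ = (commHom A b⁻¹ (⟨x, hx⟩⁻¹ : A) : G) := by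
        change _ = (((⟨x, hx⟩⁻¹ : A)⁻¹ * MulAut.conjNormal b⁻¹⁻¹ (⟨x, hx⟩⁻¹ : A) : A) : G)
        rw [inv_inv, inv_inv, coe_mul, MulAut.conjNormal_apply, commutatorElement_def]
        simp only [InvMemClass.coe_inv, mul_assoc]
      rw [heq, hT]
      exact ⟨SetLike.coe_mem _, A.subtype.isOfFinOrder htor⟩
    refine finByNil_top_of_commutator_le hTf hAT hAfg ?_
    have hq := QuotientGroup.mk'_surjective A
    have : (R.map (QuotientGroup.mk' A)).Normal := Normal.map inferInstance _ hq
    have := finiteIndex_map hq R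
    refine ih (R.map (QuotientGroup.mk' A)) ?_ _ (hS.image _) (closure_image_mk'_eq_top A hgen)
      (isAlmostEngel_image_mk' A hE)
    rw [← map_lowerCentralSeries, Subgroup.map_eq_bot_iff, QuotientGroup.ker_mk']

/-- If `G / A` is finite-by-nilpotent, so is `G`. The preimage `C` of the centraliser of a finite term
`N` of the lower central series of `G / A` has finite index and is nilpotent modulo `A`. Its radical
`R` contains a power of every generator, so `G / R` is finite; therefore `R` is finitely generated
and finite-by-nilpotent, which leaves the virtually nilpotent case. -/
theorem finByNil_top_of_quotient_isMulCommutative {G : Type u} [Group G] {A : Subgroup G}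
    [A.Normal] [IsMulCommutative A] {S : Set G} (hS : S.Finite) (hgen : closure S = ⊤)
    (hE : ∀ a ∈ S, IsAlmostEngel a) (h : FinByNil (⊤ : Subgroup (G ⧸ A))) :
    FinByNil (⊤ : Subgroup G) := by
  have hAA : ⁅A, A⁆ = ⊥ := commutator_self_eq_bot_iff.2 inferInstance
  have hG : Group.FG G := Group.fg_iff.2 ⟨S, hgen, hS⟩
  obtain ⟨n, hn⟩ := id h
  let q := QuotientGroup.mk' A
  let N := (⊤ : Subgroup (G ⧸ A)).lowerCentralSeries n
  have hNfin : Finite N := hn.to_subtype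
  -- the elements of `G` that centralise the finite subgroup `N` of `G ⧸ A`
  let ψ : G →* MulAut N := MulAut.conjNormal.comp q
  have : Finite (MulAut N) := Finite.of_injective (fun e : MulAut N => (e : N → N))
    DFunLike.coe_injective
  let C : Subgroup G := ψ.ker
  have hCN : ∀ c ∈ C, ∀ y ∈ N, y * q c = q c * y := by
    intro c hc y hy
    have h1 : (MulAut.conjNormal (q c) : MulAut N) = 1 := hc
    have h2 := congrArg Subtype.val (DFunLike.congr_fun h1 (⟨y, hy⟩ : N))
    rw [MulAut.conjNormal_apply] at h2
    exact (mul_inv_eq_iff_eq_mul.1 h2).symm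
  have hAC : A ≤ C := fun x hx => by
    have hx1 : q x = 1 := (QuotientGroup.eq_one_iff x).2 hx
    rw [MonoidHom.mem_ker, MonoidHom.comp_apply, hx1, map_one]
  have hCA : C.lowerCentralSeries (n + 1) ≤ A := by
    rw [← QuotientGroup.ker_mk' A, ← Subgroup.map_eq_bot_iff, map_lowerCentralSeries, eq_bot_iff,
      Subgroup.lowerCentralSeries_succ, commutator_le]
    rintro y hy _ ⟨c, hc, rfl⟩
    rw [mem_bot, commutatorElement_eq_one_iff_mul_comm]
    exact hCN c hc y (lowerCentralSeries_mono n le_top hy)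
  let R := locRadical C
  have hRn : R.Normal := by
    rw [← normalizer_eq_top_iff, eq_top_iff, ← normalizer_eq_top (H := C)]
    exact normalizer_le_normalizer_locRadical C
  have hAR : A ≤ R :=
    le_locRadical_of_lowerCentralSeries_le hCA hAC (FinByNil.locFinByNil ⟨1, by simp [hAA]⟩)
  have hSR : ∀ a ∈ S, a ^ C.index ∈ R := by
    intro a ha
    have hX : LocFinByNil (A ⊔ zpowers (a ^ C.index)) :=
      (locFinByNil_sup_zpowers A (hE a ha)).mono (sup_le_sup_left (by simp) A)
    refine le_locRadical_of_lowerCentralSeries_le (hCA.trans le_sup_left)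
      (sup_le hAC ?_) hX (mem_sup_right (mem_zpowers _))
    simpa using C.pow_index_mem a
  have hfin : Finite (G ⧸ R) := by
    refine finite_of_finByNil_of_torsion ?_ (hS.image (QuotientGroup.mk' R))
      (closure_image_mk'_eq_top R hgen) ?_
    · have hr := QuotientGroup.mk'_surjective R
      have hA : A ≤ (QuotientGroup.mk' R).ker := by rwa [QuotientGroup.ker_mk']
      exact h.top_of_surjective (QuotientGroup.lift_surjective_of_surjective A _ hr hA)
    · rintro _ ⟨a, ha, rfl⟩
      refine isOfFinOrder_iff_pow_eq_one.2
        ⟨C.index, Nat.pos_of_ne_zero FiniteIndex.index_ne_zero, ?_⟩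
      rw [← map_pow]
      exact (QuotientGroup.eq_one_iff _).2 (hSR a ha)
  have hRi : R.FiniteIndex := finiteIndex_of_finite_quotient
  have hRfg : R.FG := (Group.fg_iff_subgroup_fg R).1 inferInstance
  obtain ⟨m, hm⟩ := locFinByNil_locRadical C R le_rfl hRfg
  refine FinByNil.of_quotient hm ?_
  have hr := QuotientGroup.mk'_surjective (R.lowerCentralSeries m)
  have := Normal.map hRn _ hr
  have := finiteIndex_map hr R
  refine finByNil_top_of_nilpotent_finiteIndex m (R.map (QuotientGroup.mk' _)) ?_ _ (hS.image _)
    (closure_image_mk'_eq_top _ hgen) (isAlmostEngel_image_mk' _ hE)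
  rw [← map_lowerCentralSeries, Subgroup.map_eq_bot_iff, QuotientGroup.ker_mk']

/-- Induction on the derived length of a soluble normal subgroup `H` of finite index, with the last
nontrivial term of its derived series as the abelian normal subgroup. -/
theorem finByNil_top_of_derivedSeries_eq_bot (d : ℕ) : ∀ {G : Type u} [Group G]
    (H : Subgroup G) [H.Normal] [H.FiniteIndex], derivedSeries H d = ⊥ →
    ∀ S : Set G, S.Finite → closure S = ⊤ → (∀ a ∈ S, IsAlmostEngel a) →
    FinByNil (⊤ : Subgroup G) := by
  induction d with
  | zero =>
    intro G _ H _ hHf hH S _ _ _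
    have hbot : H = ⊥ := by
      have := congrArg (Subgroup.map H.subtype) hH
      rwa [derivedSeries_zero, ← MonoidHom.range_eq_map, range_subtype, Subgroup.map_bot] at this
    rw [hbot] at hHf
    exact finByNil_top_of_finiteIndex_bot
  | succ d ih =>
    intro G _ H _ _ hH S hS hgen hE
    let A := (derivedSeries H d).map H.subtype
    have hA : A.Normal := inferInstance
    have hAA : IsMulCommutative A := by
      rw [← commutator_self_eq_bot_iff, ← map_commutator, ← derivedSeries_succ, hH,
        Subgroup.map_bot]
    refine finByNil_top_of_quotient_isMulCommutative (A := A) hS hgen hE ?_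
    have hq := QuotientGroup.mk'_surjective A
    have := Normal.map (H := H) inferInstance _ hq
    have := finiteIndex_map hq H
    refine ih (H.map (QuotientGroup.mk' A)) ?_ _ (hS.image _) (closure_image_mk'_eq_top A hgen)
      (isAlmostEngel_image_mk' A hE)
    rw [← map_derivedSeries_eq ((QuotientGroup.mk' A).subgroupMap_surjective H),
      Subgroup.map_eq_bot_iff]
    intro x hx
    exact Subtype.ext ((QuotientGroup.eq_one_iff (x : G)).2 (mem_map_of_mem H.subtype hx))

end AlmostEngel

theorem theorem3p3 {G : Type*} [Group G] (hG : AlmostEngel.IsVirtuallySoluble G)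
    (S : Set G) (hS : S.Finite) (hgen : Subgroup.closure S = ⊤)
    (hEngel : ∀ a ∈ S, AlmostEngel.IsAlmostEngel a) :
    AlmostEngel.IsFiniteByNilpotent G := by
  obtain ⟨H, hHf, hHs⟩ := hG
  have : Group.IsSolvable H.normalCore :=
    Group.isSolvable_of_isSolvable_injective (Subgroup.inclusion_injective H.normalCore_le)
  obtain ⟨d, hd⟩ := this.solvable
  exact (AlmostEngel.finByNil_top_of_derivedSeries_eq_bot d H.normalCore hd S hS hgen
    hEngel).isFiniteByNilpotent
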